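/- Let $\gamma>\frac12$ and, for $v\in\mathbb{R}$, let $$W(v)=\frac{\gamma}{(1+v^2)^2}\big[(\gamma+1)v^2-1\big].$$ Then there exist $\lambda_0>0$ and $\eta_0>0$ such that, for every $\lambda\in\mathbb{C}$ with $|\lambda|\le\lambda_0$ and every $\eta\in[0,\eta_0]$, the problem $$\Big(-\partial_v^2+W(v)+i\eta v-\lambda\eta^{2/3}\Big)J_{\lambda,\eta}(v)=0\quad (v\in[0,\infty)),\qquad J_{\lambda,\eta}(0)=1,$$ has one and only one (twice differentiable, complex-valued) solution $J_{\lambda,\eta}$ on $[0,\infty)$ satisfying $$\int_0^\infty|J_{\lambda,\eta}(v)|^2\,dv<\infty.$$ Moreover, $(\lambda,\eta,v)\mapsto J_{\lambda,\eta}(v)$ is continuous on $\{\lambda\in\mathbb{C}:|\lambda|\le\lambda_0\}\times[0,\eta_0]\times[0,\infty)$, and for every $\eta\in[0,\eta_0]$ and $v\in[0,\infty)$ the function $\lambda\mapsto J_{\lambda,\eta}(v)$ is holomorphic on $\{\lambda\in\mathbb{C}:|\lambda|<\lambda_0\}$. -/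

import Mathlib

open Set MeasureTheory

/-- The potential `W(v) = γ ((γ + 1) v² - 1) / (1 + v²)²`. -/
noncomputable def potentialW (γ v : ℝ) : ℝ :=
  γ / (1 + v ^ 2) ^ 2 * (v ^ 2 * (γ + 1) - 1)

/-- `f` is a classical (twice differentiable up to the boundary point `0`) solution on `[0, ∞)` of
`(-∂_v² + W(v) + i η v - lam η^{2/3}) f = 0`. Only the values of `f` on `[0, ∞)` matter. -/
def SolvesODE (γ : ℝ) (lam : ℂ) (η : ℝ) (f : ℝ → ℂ) : Prop :=
  ∃ f₁ f₂ : ℝ → ℂ, ∀ v ∈ Ici (0 : ℝ),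
    HasDerivWithinAt f (f₁ v) (Ici 0) v ∧
    HasDerivWithinAt f₁ (f₂ v) (Ici 0) v ∧
    -f₂ v + (potentialW γ v : ℂ) * f v + Complex.I * (η : ℂ) * (v : ℂ) * f v
      - lam * ((η ^ (2 / 3 : ℝ) : ℝ) : ℂ) * f v = 0

/-- Square integrable solution on `[0, ∞)` normalized by the value `1` at `0`. -/
structure IsL2Solution (γ : ℝ) (lam : ℂ) (η : ℝ) (f : ℝ → ℂ) : Prop where
  ode : SolvesODE γ lam η f
  value_zero : f 0 = 1
  memLp : MemLp f 2 (volume.restrict (Ici (0 : ℝ)))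

/-! ### Linear differential equations depending continuously on a parameter -/

/-! This is Weyl's limit-point construction, driven by a monotone energy. Let `φ`, `ψ` be the
solutions with data `(1, 0)` and `(0, 1)` at `0`. They are jointly continuous in all variables
(Picard series) and entire in `lam` (Wronskian identity).

With `b = drift γ` one has `W = b' + b²`, so the equation becomes the system `y' = D + b y`, `D' =
-b D + (i η v - lam η^{2/3}) y`. Hence `Re ((1 - i) D conj y)` has derivative `‖D‖² + (η v - (Re lam
+ Im lam) η^{2/3}) ‖y‖²`. Near `v = 0` the spectral term may dominate `η v`; subtracting a small
multiple of `‖y‖²` repairs this. The resulting energy `E` satisfies `E' ≥ (‖D‖² + η v ‖y‖²) / 2` for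
`‖lam‖ ≤ 1/16` (`energy_inequality`), uniformly down to `η = 0`.

Along `ψ` the energy starts at `0`, is positive and tends to infinity. Since `E² ≤ 2 ‖D‖² ‖ψ‖²`, it
follows that `1 / ‖ψ‖² ≤ (-4 / E)'`. As `(-φ / ψ)' = 1 / ψ²`, the Dirichlet slopes `-φ / ψ` converge
with error `4 / E`, locally uniformly in the parameters (`norm_dirichletSlope_sub_le`). Their limit
`m` is therefore continuous, and holomorphic in `lam`.

The solution is `φ + m ψ`. As a limit of solutions vanishing far out, it has energy at most `0`; so
`E'` is integrable, which gives square integrability for `η > 0`. For `η = 0` it forces `m = 0`, and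
the solution is `(1 + v²)^(-γ/2)`. Uniqueness holds because `ψ` is not square integrable: `1 / ‖ψ‖²`
is integrable on `(1, ∞)`, and `t + 1/t ≥ 1`. -/

theorem summable_picard_bound (c x : ℝ) :
    Summable fun n : ℕ => c * (x ^ n / n.factorial) :=
  (Real.summable_pow_div_factorial x).mul_left _

section LinearODE

variable {P E : Type*} [NormedAddCommGroup E] [NormedSpace ℝ E]

/-- The terms of the Picard series of the problem `Y' = A Y`, `Y 0 = y₀`. -/
noncomputable def picardTerm (A : P → ℝ → E →L[ℝ] E) (y₀ : E) : ℕ → P → ℝ → E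
  | 0 => fun _ _ => y₀
  | n + 1 => fun p v => ∫ s in (0 : ℝ)..v, A p s (picardTerm A y₀ n p s)

/-- The sum of the Picard series. -/
noncomputable def picardSum (A : P → ℝ → E →L[ℝ] E) (y₀ : E) (p : P) (v : ℝ) : E :=
  ∑' n, picardTerm A y₀ n p v

variable {A : P → ℝ → E →L[ℝ] E} {y₀ : E}

theorem picardSum_zero (p : P) : picardSum A y₀ p 0 = y₀ := by
  rw [picardSum, tsum_eq_single 0]
  · rfl
  · rintro (_ | n) hn
    · exact absurd rfl hn
    · simp [picardTerm]

variable [TopologicalSpace P]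

theorem continuous_picardTerm (hA : Continuous fun x : P × ℝ => A x.1 x.2) (n : ℕ) :
    Continuous fun x : P × ℝ => picardTerm A y₀ n x.1 x.2 := by
  induction n with
  | zero => exact continuous_const
  | succ n ih =>
    exact intervalIntegral.continuous_parametric_primitive_of_continuous
      (f := fun p s => A p s (picardTerm A y₀ n p s)) (hA.clm_apply ih)

theorem continuous_picardTerm_right (hA : Continuous fun x : P × ℝ => A x.1 x.2) (n : ℕ) (p : P) :
    Continuous fun v => picardTerm A y₀ n p v :=
  (continuous_picardTerm hA n).comp (Continuous.prodMk_right p)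

theorem norm_picardTerm_le (hA : Continuous fun x : P × ℝ => A x.1 x.2) {p : P} {T C : ℝ}
    (hC : ∀ s, |s| ≤ T → ‖A p s‖ ≤ C) (n : ℕ) {v : ℝ} (hv : |v| ≤ T) :
    ‖picardTerm A y₀ n p v‖ ≤ ‖y₀‖ * ((C * |v|) ^ n / n.factorial) := by
  have hT : 0 ≤ T := (abs_nonneg v).trans hv
  have hC0 : 0 ≤ C := (norm_nonneg _).trans (hC 0 (by simpa using hT))
  induction n generalizing v with
  | zero => simp [picardTerm]
  | succ n ih =>
    have hle : ∀ s ∈ Set.uIoc 0 v, |s| ≤ |v| := by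
      intro s hs
      have := Set.abs_sub_left_of_mem_uIcc (Set.uIoc_subset_uIcc hs)
      simpa using this
    have h1 : ‖picardTerm A y₀ (n + 1) p v‖
        ≤ ∫ s in Set.uIoc 0 v, C * (‖y₀‖ * (C ^ n / n.factorial)) * |s - 0| ^ n := by
      refine (intervalIntegral.norm_integral_le_integral_norm_uIoc).trans ?_
      have hc := (hA.comp (Continuous.prodMk_right p)).clm_apply
        (continuous_picardTerm_right (y₀ := y₀) hA n p)
      refine setIntegral_mono_on (hc.norm.integrableOn_uIoc) ?_ measurableSet_uIoc ?_
      · exact Continuous.integrableOn_uIoc (by fun_prop)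
      · intro s hs
        have hsT := (hle s hs).trans hv
        calc ‖A p s (picardTerm A y₀ n p s)‖ ≤ ‖A p s‖ * ‖picardTerm A y₀ n p s‖ :=
              (A p s).le_opNorm _
          _ ≤ C * (‖y₀‖ * ((C * |s|) ^ n / n.factorial)) :=
              mul_le_mul (hC s hsT) (ih hsT) (norm_nonneg _) hC0
          _ = _ := by rw [sub_zero]; ring
    refine h1.trans (le_of_eq ?_)
    rw [integral_const_mul, integral_pow_abs_sub_uIoc, sub_zero, Nat.factorial_succ]
    push_cast
    field_simp
    ring

/-- The tube lemma over the compact interval `[-T, T]` supplies the local uniformity in the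
parameter, with no local compactness of `P`. -/
theorem exists_nhds_norm_le (hA : Continuous fun x : P × ℝ => A x.1 x.2) (p : P) (T : ℝ) :
    ∃ U : Set P, IsOpen U ∧ p ∈ U ∧ ∃ C, ∀ p' ∈ U, ∀ s, |s| ≤ T → ‖A p' s‖ ≤ C := by
  have hc : IsCompact (Icc (-T) T) := isCompact_Icc
  obtain ⟨C, hC⟩ := hc.exists_bound_of_continuousOn
    (f := fun s => A p s) (hA.comp (Continuous.prodMk_right p)).continuousOn
  obtain ⟨u, v, hu, -, hpu, hTv, huv⟩ := generalized_tube_lemma (isCompact_singleton (x := p)) hc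
    (n := {x : P × ℝ | ‖A x.1 x.2‖ < C + 1}) (isOpen_lt hA.norm continuous_const) (by
      rintro ⟨p', s⟩ ⟨hp', hs⟩
      rw [mem_singleton_iff] at hp'
      subst hp'
      exact (hC s hs).trans_lt (lt_add_one C))
  refine ⟨u, hu, hpu rfl, C + 1, fun p' hp' s hs => ?_⟩
  have h := @huv (p', s) ⟨hp', hTv (abs_le.1 hs)⟩
  exact le_of_lt h

theorem norm_picardTerm_le_uniform (hA : Continuous fun x : P × ℝ => A x.1 x.2) {p : P} {T C : ℝ}
    (hC : ∀ s, |s| ≤ T → ‖A p s‖ ≤ C) (n : ℕ) {v : ℝ} (hv : |v| ≤ T) :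
    ‖picardTerm A y₀ n p v‖ ≤ ‖y₀‖ * ((C * T) ^ n / n.factorial) := by
  have hT : 0 ≤ T := (abs_nonneg v).trans hv
  have hC0 : 0 ≤ C := (norm_nonneg _).trans (hC 0 (by simpa using hT))
  refine (norm_picardTerm_le hA hC n hv).trans ?_
  gcongr

variable [CompleteSpace E]

theorem continuous_picardSum (hA : Continuous fun x : P × ℝ => A x.1 x.2) :
    Continuous fun x : P × ℝ => picardSum A y₀ x.1 x.2 := by
  rw [continuous_iff_continuousAt]
  rintro ⟨p, v⟩
  obtain ⟨U, hU, hpU, C, hC⟩ := exists_nhds_norm_le hA p (|v| + 1)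
  have ho : IsOpen {s : ℝ | |s| < |v| + 1} := isOpen_lt continuous_abs continuous_const
  have := continuousOn_tsum (f := fun n (x : P × ℝ) => picardTerm A y₀ n x.1 x.2)
    (s := U ×ˢ {s : ℝ | |s| < |v| + 1}) (fun n => (continuous_picardTerm hA n).continuousOn)
    (summable_picard_bound ‖y₀‖ (C * (|v| + 1)))
    (fun n x hx => norm_picardTerm_le_uniform hA (hC x.1 hx.1) n (le_of_lt hx.2))
  exact this.continuousAt ((hU.prod ho).mem_nhds ⟨hpU, lt_add_one |v|⟩)

theorem hasDerivAt_picardSum (hA : Continuous fun x : P × ℝ => A x.1 x.2) (p : P) (v : ℝ) :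
    HasDerivAt (picardSum A y₀ p) (A p v (picardSum A y₀ p v)) v := by
  obtain ⟨U, -, hpU, C, hC⟩ := exists_nhds_norm_le hA p (|v| + 1)
  have hCp := hC p hpU
  set T := |v| + 1 with hTdef
  have hT : 0 < T := by positivity
  have hC0 : 0 ≤ C := (norm_nonneg _).trans (hCp 0 (by simpa using hT.le))
  have hsum : ∀ w, |w| ≤ T → Summable fun n => picardTerm A y₀ n p w := fun w hw =>
    Summable.of_norm_bounded (summable_picard_bound ‖y₀‖ (C * T))
      (fun n => norm_picardTerm_le_uniform hA hCp n hw)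
  have key := hasDerivAt_tsum_of_isPreconnected (𝕜 := ℝ)
    (u := fun n : ℕ => C * (‖y₀‖ * ((C * T) ^ n / n.factorial)))
    (g := fun n w => picardTerm A y₀ (n + 1) p w)
    (g' := fun n w => A p w (picardTerm A y₀ n p w)) (t := Metric.ball 0 T) (y₀ := 0) (y := v)
    ((summable_picard_bound ‖y₀‖ (C * T)).mul_left C) Metric.isOpen_ball
    (convex_ball 0 T).isPreconnected
    (fun n w _ => by
      have hc := (hA.comp (Continuous.prodMk_right p)).clm_apply
        (continuous_picardTerm_right (y₀ := y₀) hA n p)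
      exact hc.integral_hasStrictDerivAt 0 w |>.hasDerivAt)
    (fun n w hw => by
      have hw' : |w| ≤ T := by simpa using (Metric.mem_ball.1 hw).le
      exact ((A p w).le_opNorm _).trans (mul_le_mul (hCp w hw')
        (norm_picardTerm_le_uniform hA hCp n hw') (norm_nonneg _) hC0))
    (Metric.mem_ball_self hT)
    ((summable_nat_add_iff 1).2 (hsum 0 (by simpa using hT.le)))
    (by simp [hTdef])
  have hv : |v| ≤ T := by simp [hTdef]
  have h2 : ∑' n, A p v (picardTerm A y₀ n p v) = A p v (picardSum A y₀ p v) :=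
    ((A p v).map_tsum (hsum v hv)).symm
  rw [h2] at key
  -- The term of index `0` is constant; differentiating the shifted series reproduces the original
  -- one under `A`.
  have h3 : ∀ᶠ w in nhds v, picardSum A y₀ p w = y₀ + ∑' n, picardTerm A y₀ (n + 1) p w := by
    have ho : IsOpen {s : ℝ | |s| < T} := isOpen_lt continuous_abs continuous_const
    filter_upwards [ho.mem_nhds (show |v| < T by simp [hTdef])] with w hw
    rw [picardSum, (hsum w (le_of_lt hw)).tsum_eq_zero_add]
    rfl
  exact (key.const_add y₀).congr_of_eventuallyEq h3

end LinearODE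

/-- The first order system of `y'' = q y`. -/
noncomputable def companionMap (q : ℂ) : (ℂ × ℂ) →L[ℝ] (ℂ × ℂ) :=
  (ContinuousLinearMap.snd ℝ ℂ ℂ).prod (q • ContinuousLinearMap.fst ℝ ℂ ℂ)

theorem continuous_companionMap : Continuous companionMap := by
  have h : companionMap = fun q : ℂ => (ContinuousLinearMap.prodₗᵢ ℝ)
      (ContinuousLinearMap.snd ℝ ℂ ℂ, q • ContinuousLinearMap.fst ℝ ℂ ℂ) := rfl
  rw [h]
  exact (LinearIsometryEquiv.continuous _).comp (by fun_prop)

/-- Solutions of `y'' = q y` with prescribed data at `0` depend continuously on parameters. -/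
theorem exists_continuous_solution {P : Type*} [TopologicalSpace P] {q : P → ℝ → ℂ}
    (hq : Continuous fun x : P × ℝ => q x.1 x.2) (c d : ℂ) :
    ∃ y z : P → ℝ → ℂ, (Continuous fun x : P × ℝ => y x.1 x.2) ∧
      (Continuous fun x : P × ℝ => z x.1 x.2) ∧ ∀ p, y p 0 = c ∧ z p 0 = d ∧
        ∀ v, HasDerivAt (y p) (z p v) v ∧ HasDerivAt (z p) (q p v * y p v) v := by
  have hA : Continuous fun x : P × ℝ => companionMap (q x.1 x.2) := continuous_companionMap.comp hq
  have hS := continuous_picardSum (A := fun p v => companionMap (q p v)) (y₀ := (c, d)) hA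
  refine ⟨fun p v => (picardSum (fun p v => companionMap (q p v)) (c, d) p v).1,
    fun p v => (picardSum (fun p v => companionMap (q p v)) (c, d) p v).2,
    continuous_fst.comp hS, continuous_snd.comp hS, fun p => ⟨?_, ?_, fun v => ?_⟩⟩
  · simp only [picardSum_zero]
  · simp only [picardSum_zero]
  · have h := hasDerivAt_picardSum (A := fun p v => companionMap (q p v)) (y₀ := (c, d)) hA p v
    exact ⟨(ContinuousLinearMap.fst ℝ ℂ ℂ).hasFDerivAt.comp_hasDerivAt v h,
      (ContinuousLinearMap.snd ℝ ℂ ℂ).hasFDerivAt.comp_hasDerivAt v h⟩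

/-! ### The Schrödinger equation with a complex linear potential -/

/-- The coefficient `q` for which the equation reads `y'' = q y`. -/
noncomputable def schrodingerCoeff (γ : ℝ) (lam : ℂ) (η v : ℝ) : ℂ :=
  (potentialW γ v : ℂ) + Complex.I * (η : ℂ) * (v : ℂ) - lam * ((η ^ (2 / 3 : ℝ) : ℝ) : ℂ)

/-- `y` solves the equation on the whole line, and `z` is its derivative. -/
def IsSolutionPair (γ : ℝ) (lam : ℂ) (η : ℝ) (y z : ℝ → ℂ) : Prop :=
  ∀ v, HasDerivAt y (z v) v ∧ HasDerivAt z (schrodingerCoeff γ lam η v * y v) v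

/-- The logarithmic derivative of `(1 + v²)^(-γ/2)`. -/
noncomputable def drift (γ v : ℝ) : ℝ := -γ * v / (1 + v ^ 2)

/-- This is the Riccati identity `W = b' + b²`, equivalent to the factorization `-∂² + W = -(∂ +
b)(∂ - b)`. -/
theorem hasDerivAt_drift (γ v : ℝ) :
    HasDerivAt (drift γ) (potentialW γ v - drift γ v ^ 2) v := by
  have h0 : (1 + v ^ 2 : ℝ) ≠ 0 := by positivity
  have h := ((hasDerivAt_id v).const_mul (-γ)).div (((hasDerivAt_id v).pow 2).const_add 1) h0
  refine h.congr_deriv ?_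
  simp only [potentialW, drift, id, Pi.pow_apply]
  field_simp
  ring

theorem continuous_schrodingerCoeff (γ : ℝ) :
    Continuous fun x : (ℂ × ℝ) × ℝ => schrodingerCoeff γ x.1.1 x.1.2 x.2 := by
  have h1 : Continuous (potentialW γ) := by
    unfold potentialW
    refine Continuous.mul (continuous_const.div (by fun_prop) fun v => ?_) (by fun_prop)
    positivity
  have h2 : Continuous fun η : ℝ => η ^ (2 / 3 : ℝ) := Real.continuous_rpow_const (by norm_num)
  unfold schrodingerCoeff
  have h1' := h1.comp (continuous_snd (X := ℂ × ℝ) (Y := ℝ))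
  have h2' := h2.comp (continuous_snd.comp (continuous_fst (X := ℂ × ℝ) (Y := ℝ)))
  simp only [Function.comp_def] at h1' h2'
  fun_prop

namespace IsSolutionPair

variable {γ η : ℝ} {lam : ℂ} {y z y' z' : ℝ → ℂ}

theorem continuous (h : IsSolutionPair γ lam η y z) : Continuous y :=
  continuous_iff_continuousAt.2 fun v => (h v).1.continuousAt

theorem add_mul (h : IsSolutionPair γ lam η y z) (h' : IsSolutionPair γ lam η y' z') (c : ℂ) :
    IsSolutionPair γ lam η (fun v => y v + c * y' v) (fun v => z v + c * z' v) := fun v =>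
  ⟨(h v).1.add ((h' v).1.const_mul c),
    ((h v).2.add ((h' v).2.const_mul c)).congr_deriv (by ring)⟩

/-- Two spectral parameters are allowed: equal ones give conservation of the Wronskian, different
ones give the difference quotient in `lam`. -/
theorem wronskian_eq {mu : ℂ} (h : IsSolutionPair γ mu η y z)
    (h' : IsSolutionPair γ lam η y' z') (v : ℝ) :
    y v * z' v - z v * y' v = y 0 * z' 0 - z 0 * y' 0 +
      (mu - lam) * ((η ^ (2 / 3 : ℝ) : ℝ) : ℂ) * ∫ s in (0 : ℝ)..v, y s * y' s := by
  have hd : ∀ s, HasDerivAt (fun v => y v * z' v - z v * y' v)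
      ((mu - lam) * ((η ^ (2 / 3 : ℝ) : ℝ) : ℂ) * (y s * y' s)) s := fun s => by
    refine (((h s).1.mul (h' s).2).sub ((h s).2.mul (h' s).1)).congr_deriv ?_
    simp only [schrodingerCoeff]
    ring
  have hc : Continuous fun s => (mu - lam) * ((η ^ (2 / 3 : ℝ) : ℝ) : ℂ) * (y s * y' s) :=
    continuous_const.mul (h.continuous.mul h'.continuous)
  have := intervalIntegral.integral_eq_sub_of_hasDerivAt (a := 0) (b := v)
    (fun s _ => hd s) (hc.intervalIntegrable _ _)
  rw [intervalIntegral.integral_const_mul] at this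
  rw [this]
  ring

theorem wronskian_const (h : IsSolutionPair γ lam η y z)
    (h' : IsSolutionPair γ lam η y' z') (v : ℝ) :
    y v * z' v - z v * y' v = y 0 * z' 0 - z 0 * y' 0 := by
  simpa using h.wronskian_eq h' v

end IsSolutionPair

/-- The functions `φ` and `ψ` below are the fundamental system at `0`, with derivatives. -/
structure IsFundamentalSystem (γ : ℝ) (φ φ' ψ ψ' : ℂ → ℝ → ℝ → ℂ) : Prop where
  continuous_fst : Continuous fun x : (ℂ × ℝ) × ℝ => φ x.1.1 x.1.2 x.2
  continuous_fst_deriv : Continuous fun x : (ℂ × ℝ) × ℝ => φ' x.1.1 x.1.2 x.2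
  continuous_snd : Continuous fun x : (ℂ × ℝ) × ℝ => ψ x.1.1 x.1.2 x.2
  continuous_snd_deriv : Continuous fun x : (ℂ × ℝ) × ℝ => ψ' x.1.1 x.1.2 x.2
  pair_fst : ∀ lam η, IsSolutionPair γ lam η (φ lam η) (φ' lam η)
  pair_snd : ∀ lam η, IsSolutionPair γ lam η (ψ lam η) (ψ' lam η)
  fst_zero : ∀ lam η, φ lam η 0 = 1
  fst_deriv_zero : ∀ lam η, φ' lam η 0 = 0
  snd_zero : ∀ lam η, ψ lam η 0 = 0
  snd_deriv_zero : ∀ lam η, ψ' lam η 0 = 1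

theorem exists_isFundamentalSystem (γ : ℝ) : ∃ φ φ' ψ ψ', IsFundamentalSystem γ φ φ' ψ ψ' := by
  obtain ⟨y, z, hy, hz, h⟩ := exists_continuous_solution
    (q := fun p : ℂ × ℝ => schrodingerCoeff γ p.1 p.2) (continuous_schrodingerCoeff γ) 1 0
  obtain ⟨y', z', hy', hz', h'⟩ := exists_continuous_solution
    (q := fun p : ℂ × ℝ => schrodingerCoeff γ p.1 p.2) (continuous_schrodingerCoeff γ) 0 1
  exact ⟨fun l η => y (l, η), fun l η => z (l, η), fun l η => y' (l, η), fun l η => z' (l, η),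
    hy, hz, hy', hz', fun l η => (h (l, η)).2.2, fun l η => (h' (l, η)).2.2,
    fun l η => (h (l, η)).1, fun l η => (h (l, η)).2.1, fun l η => (h' (l, η)).1,
    fun l η => (h' (l, η)).2.1⟩

/-! ### Holomorphy of the fundamental system in the spectral parameter. -/

namespace IsFundamentalSystem

variable {γ : ℝ} {φ φ' ψ ψ' : ℂ → ℝ → ℝ → ℂ}

theorem wronskian (h : IsFundamentalSystem γ φ φ' ψ ψ') (lam : ℂ) (η v : ℝ) :
    φ lam η v * ψ' lam η v - φ' lam η v * ψ lam η v = 1 := by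
  rw [(h.pair_fst lam η).wronskian_const (h.pair_snd lam η), h.fst_zero, h.fst_deriv_zero,
    h.snd_deriv_zero]
  ring

/-- Solutions depending continuously on the spectral parameter, with initial data independent of
it, depend holomorphically on it. -/
theorem differentiable_solution (h : IsFundamentalSystem γ φ φ' ψ ψ') {η : ℝ} {u w : ℂ → ℝ → ℂ}
    (hu : Continuous fun x : ℂ × ℝ => u x.1 x.2)
    (hp : ∀ lam, IsSolutionPair γ lam η (u lam) (w lam)) {c d : ℂ}
    (hc : ∀ lam, u lam 0 = c) (hd : ∀ lam, w lam 0 = d) (v : ℝ) :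
    Differentiable ℂ fun lam => u lam v := by
  intro lam
  set κ : ℂ := ((η ^ (2 / 3 : ℝ) : ℝ) : ℂ)
  set G : ℂ → ℂ := fun mu => κ * ((∫ s in (0 : ℝ)..v, u mu s * ψ lam η s) * φ lam η v
    - (∫ s in (0 : ℝ)..v, u mu s * φ lam η s) * ψ lam η v)
  -- Variation of constants around `lam`; continuity of `G` then makes `G lam` the complex
  -- derivative.
  have hrep : ∀ mu, u mu v = c * φ lam η v + d * ψ lam η v + (mu - lam) * G mu := by
    intro mu
    have h1 := (hp mu).wronskian_eq (h.pair_snd lam η) v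
    have h2 := (hp mu).wronskian_eq (h.pair_fst lam η) v
    have h3 := h.wronskian lam η v
    rw [hc, hd, h.snd_zero, h.snd_deriv_zero] at h1
    rw [hc, hd, h.fst_zero, h.fst_deriv_zero] at h2
    simp only [G]
    linear_combination φ lam η v * h1 - ψ lam η v * h2 - u mu v * h3
  have hG : Continuous G := by
    have hI : ∀ f : ℝ → ℂ, Continuous f →
        Continuous fun mu : ℂ => ∫ s in (0 : ℝ)..v, u mu s * f s := fun f hf =>
      intervalIntegral.continuous_parametric_intervalIntegral_of_continuous
        (f := fun mu s => u mu s * f s) (hu.mul (hf.comp _root_.continuous_snd)) continuous_const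
    exact continuous_const.mul (((hI _ (h.pair_snd lam η).continuous).mul continuous_const).sub
      ((hI _ (h.pair_fst lam η).continuous).mul continuous_const))
  refine HasDerivAt.differentiableAt (f' := G lam) ?_
  rw [hasDerivAt_iff_tendsto_slope]
  refine (hG.continuousAt.tendsto.mono_left nhdsWithin_le_nhds).congr' ?_
  filter_upwards [self_mem_nhdsWithin] with mu hmu
  have hne : mu - lam ≠ 0 := sub_ne_zero.2 hmu
  rw [slope_def_field, hrep mu, hrep lam]
  field_simp
  ring

theorem differentiable_fst (h : IsFundamentalSystem γ φ φ' ψ ψ') (η v : ℝ) :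
    Differentiable ℂ fun lam => φ lam η v :=
  h.differentiable_solution (u := fun lam => φ lam η) (w := fun lam => φ' lam η)
    (h.continuous_fst.comp (f := fun x : ℂ × ℝ => ((x.1, η), x.2)) (by fun_prop))
    (fun lam => h.pair_fst lam η) (fun lam => h.fst_zero lam η)
    (fun lam => h.fst_deriv_zero lam η) v

theorem differentiable_snd (h : IsFundamentalSystem γ φ φ' ψ ψ') (η v : ℝ) :
    Differentiable ℂ fun lam => ψ lam η v :=
  h.differentiable_solution (u := fun lam => ψ lam η) (w := fun lam => ψ' lam η)
    (h.continuous_snd.comp (f := fun x : ℂ × ℝ => ((x.1, η), x.2)) (by fun_prop))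
    (fun lam => h.pair_snd lam η) (fun lam => h.snd_zero lam η)
    (fun lam => h.snd_deriv_zero lam η) v

end IsFundamentalSystem

/-! ### The energy functional -/

/-- The factorized derivative `y' - b y`, where `b` is the drift. -/
noncomputable def twistedDeriv (γ v : ℝ) (y z : ℂ) : ℂ := z - (drift γ v : ℂ) * y

/-- The energy `Re ((1 - i) (y' - b y) conj y)`, corrected by a weight that makes it monotone along
solutions for small spectral parameters. -/
noncomputable def energy (γ η v : ℝ) (y z : ℂ) : ℝ :=
  (twistedDeriv γ v y z).re * y.re + (twistedDeriv γ v y z).im * y.im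
    + ((twistedDeriv γ v y z).im * y.re - (twistedDeriv γ v y z).re * y.im)
    - η ^ (1 / 3 : ℝ) / (4 * (1 + η ^ (1 / 3 : ℝ) * v)) * (y.re ^ 2 + y.im ^ 2)

theorem sq_energy_le {γ η v : ℝ} (hη : 0 ≤ η) (hv : 0 ≤ v) (y z : ℂ) (h : 0 ≤ energy γ η v y z) :
    energy γ η v y z ^ 2 ≤ 2 * (‖twistedDeriv γ v y z‖ ^ 2 * ‖y‖ ^ 2) := by
  have ha : 0 ≤ η ^ (1 / 3 : ℝ) := Real.rpow_nonneg hη _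
  have hg : 0 ≤ η ^ (1 / 3 : ℝ) / (4 * (1 + η ^ (1 / 3 : ℝ) * v)) * (y.re ^ 2 + y.im ^ 2) := by
    positivity
  rw [Complex.sq_norm, Complex.sq_norm, Complex.normSq_apply, Complex.normSq_apply]
  unfold energy at h ⊢
  set D := twistedDeriv γ v y z
  set w := η ^ (1 / 3 : ℝ) / (4 * (1 + η ^ (1 / 3 : ℝ) * v)) * (y.re ^ 2 + y.im ^ 2)
  have h1 := pow_le_pow_left₀ h (sub_le_self (D.re * y.re + D.im * y.im +
    (D.im * y.re - D.re * y.im)) hg) 2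
  refine h1.trans ?_
  nlinarith [sq_nonneg (D.re * y.re + D.im * y.im - (D.im * y.re - D.re * y.im))]

theorem hasDerivAt_re {f : ℝ → ℂ} {f' : ℂ} {v : ℝ} (h : HasDerivAt f f' v) :
    HasDerivAt (fun v => (f v).re) f'.re v :=
  Complex.reCLM.hasFDerivAt.comp_hasDerivAt v h

theorem hasDerivAt_im {f : ℝ → ℂ} {f' : ℂ} {v : ℝ} (h : HasDerivAt f f' v) :
    HasDerivAt (fun v => (f v).im) f'.im v :=
  Complex.imCLM.hasFDerivAt.comp_hasDerivAt v h

theorem energy_inequality {a v b p d₁ d₂ y₁ y₂ l₁ l₂ : ℝ} (ha : 0 ≤ a) (hv : 0 ≤ v) (hb : b ≤ 0)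
    (hl₁ : l₁ ≤ 1 / 16) (hl₂ : l₂ ≤ 1 / 16) (hp : p = 1 + a * v) :
    (d₁ ^ 2 + d₂ ^ 2 + a ^ 3 * v * (y₁ ^ 2 + y₂ ^ 2)) / 2 ≤
      d₁ ^ 2 + d₂ ^ 2 + (a ^ 3 * v - (l₁ + l₂) * a ^ 2) * (y₁ ^ 2 + y₂ ^ 2)
        - (-(a ^ 2 / (4 * p ^ 2)) * (y₁ ^ 2 + y₂ ^ 2)
          + a / (4 * p) * (2 * (d₁ * y₁ + d₂ * y₂) + 2 * b * (y₁ ^ 2 + y₂ ^ 2))) := by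
  have hp0 : 0 < p := by rw [hp]; positivity
  set N := y₁ ^ 2 + y₂ ^ 2 with hN
  have hN0 : 0 ≤ N := by positivity
  set g := a / (2 * p) with hg
  have hg0 : 0 ≤ g := by positivity
  have e1 : a / (4 * p) = g / 2 := by rw [hg]; field_simp; norm_num
  have e2 : a ^ 2 / (4 * p ^ 2) = g ^ 2 := by rw [hg]; field_simp; norm_num
  have e3 : a ^ 2 * (1 - 2 * (a * v)) ≤ 4 * g ^ 2 := by
    -- With `x = a v`, `(1 - 2x)(1 + x)² = 1 - 3x² - 2x³ ≤ 1`.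
    have h1 : 1 - 2 * (a * v) ≤ 1 / p ^ 2 := by
      rw [le_div_iff₀ (by positivity), hp]
      have : 0 ≤ a * v := by positivity
      nlinarith [pow_nonneg this 2, pow_nonneg this 3]
    calc a ^ 2 * (1 - 2 * (a * v)) ≤ a ^ 2 * (1 / p ^ 2) := by gcongr
      _ = 4 * g ^ 2 := by rw [hg]; field_simp; norm_num
  rw [e1, e2]
  have e4 : 0 ≤ N * (4 * g ^ 2 - a ^ 2 * (1 - 2 * (a * v))) := mul_nonneg hN0 (by linarith)
  -- Completing the square in `d - g y` leaves `g² N / 2`, and `g² / 2 ≥ a² / 8 - a³ v / 4`. The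
  -- `1/8` absorbs `l₁ + l₂`, whence the bound `1/16` on each; the loss `a³ v / 4` is covered by the
  -- remaining `a³ v / 2`.
  have e5 : 0 ≤ N * (a ^ 2 * (1 / 8 - l₁ - l₂)) :=
    mul_nonneg hN0 (mul_nonneg (sq_nonneg a) (by linarith))
  have e6 : 0 ≤ g * (-b) * N := mul_nonneg (mul_nonneg hg0 (by linarith)) hN0
  have e7 : 0 ≤ (d₁ - g * y₁) ^ 2 + (d₂ - g * y₂) ^ 2 := by positivity
  have e8 : 0 ≤ a ^ 3 * v * N := by positivity
  rw [hN] at e4 e5 e6 e8 ⊢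
  linarith [e4, e5, e6, e7, e8]

theorem IsSolutionPair.exists_hasDerivAt_energy {γ η v : ℝ} {lam : ℂ} {y z : ℝ → ℂ}
    (h : IsSolutionPair γ lam η y z) (hγ : 0 ≤ γ) (hlam : ‖lam‖ ≤ 1 / 16) (hη : 0 ≤ η)
    (hv : 0 ≤ v) :
    ∃ e, HasDerivAt (fun v => energy γ η v (y v) (z v)) e v ∧
      (‖twistedDeriv γ v (y v) (z v)‖ ^ 2 + η * v * ‖y v‖ ^ 2) / 2 ≤ e := by
  set a := η ^ (1 / 3 : ℝ) with ha
  have ha0 : 0 ≤ a := Real.rpow_nonneg hη _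
  have ha2 : η ^ (2 / 3 : ℝ) = a ^ 2 := by
    rw [ha, ← Real.rpow_natCast, ← Real.rpow_mul hη]; norm_num
  have ha3 : η = a ^ 3 := by
    rw [ha, ← Real.rpow_natCast, ← Real.rpow_mul hη]; norm_num
  have hp : 1 + a * v ≠ 0 := by positivity
  have hD : HasDerivAt (fun v => twistedDeriv γ v (y v) (z v))
      (-(drift γ v : ℂ) * twistedDeriv γ v (y v) (z v)
        + (Complex.I * (η : ℂ) * v - lam * ((a ^ 2 : ℝ) : ℂ)) * y v) v := by
    refine ((h v).2.sub ((hasDerivAt_drift γ v).ofReal_comp.mul (h v).1)).congr_deriv ?_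
    simp only [schrodingerCoeff, twistedDeriv, ha2]
    push_cast
    ring
  have hy : HasDerivAt y (twistedDeriv γ v (y v) (z v) + (drift γ v : ℂ) * y v) v := by
    refine (h v).1.congr_deriv ?_
    simp [twistedDeriv]
  have hy₁ := hasDerivAt_re hy
  have hy₂ := hasDerivAt_im hy
  have hd₁ := hasDerivAt_re hD
  have hd₂ := hasDerivAt_im hD
  have hw : HasDerivAt (fun v => a / (4 * (1 + a * v))) (-(a ^ 2 / (4 * (1 + a * v) ^ 2))) v := by
    refine ((hasDerivAt_const v a).div ((((hasDerivAt_id v).const_mul a).const_add 1).const_mul 4)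
      (by simpa using hp)).congr_deriv ?_
    simp only [id]
    field_simp
    ring
  refine ⟨_, (((hd₁.mul hy₁).add (hd₂.mul hy₂)).add ((hd₂.mul hy₁).sub (hd₁.mul hy₂))).sub
    (hw.mul ((hy₁.pow 2).add (hy₂.pow 2))), ?_⟩
  have hb : drift γ v ≤ 0 := by
    unfold drift
    rw [neg_mul, neg_div]
    have : 0 ≤ γ * v / (1 + v ^ 2) := by positivity
    linarith
  have key := energy_inequality (a := a) (v := v) (b := drift γ v) (p := 1 + a * v)
    (d₁ := (twistedDeriv γ v (y v) (z v)).re) (d₂ := (twistedDeriv γ v (y v) (z v)).im)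
    (y₁ := (y v).re) (y₂ := (y v).im) (l₁ := lam.re) (l₂ := lam.im) ha0 hv hb
    ((Complex.re_le_norm _).trans hlam) ((Complex.im_le_norm _).trans hlam) rfl
  rw [Complex.sq_norm, Complex.sq_norm, Complex.normSq_apply, Complex.normSq_apply]
  rw [ha3]
  convert key using 1
  · ring
  · simp [-Complex.ofReal_pow]
    ring

/-! ### Growth of the energy -/

theorem add_mul_le_of_le_deriv {E E' : ℝ → ℝ} {r c v : ℝ} (hE : ∀ s, r ≤ s → HasDerivAt E (E' s) s)
    (hc : ∀ s, r ≤ s → c ≤ E' s) (hv : r ≤ v) : E r + c * (v - r) ≤ E v := by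
  have := (convex_Ici r).mul_sub_le_image_sub_of_le_deriv
    (fun s hs => (hE s hs).continuousAt.continuousWithinAt)
    (fun s hs => (hE s (interior_subset hs)).differentiableAt.differentiableWithinAt)
    (fun s hs => (hE s (interior_subset hs)).deriv ▸ hc s (interior_subset hs))
    r self_mem_Ici v hv hv
  linarith

theorem twistedDeriv_zero_left (γ : ℝ) (y z : ℂ) : twistedDeriv γ 0 y z = z := by
  simp [twistedDeriv, drift]

theorem energy_zero (γ η v : ℝ) (z : ℂ) : energy γ η v 0 z = 0 := by
  simp [energy]

/-- The square integrable solution `(1 + v²)^(-γ/2)` for vanishing parameter. -/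
noncomputable def groundState (γ v : ℝ) : ℝ := (1 + v ^ 2) ^ (-γ / 2)

theorem groundState_pos (γ v : ℝ) : 0 < groundState γ v :=
  Real.rpow_pos_of_pos (by positivity) _

theorem groundState_zero (γ : ℝ) : groundState γ 0 = 1 := by simp [groundState]

theorem groundState_le_one {γ : ℝ} (hγ : 0 ≤ γ) (v : ℝ) : groundState γ v ≤ 1 :=
  Real.rpow_le_one_of_one_le_of_nonpos (by nlinarith [sq_nonneg v]) (by linarith)

theorem hasDerivAt_groundState (γ v : ℝ) :
    HasDerivAt (groundState γ) (drift γ v * groundState γ v) v := by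
  have h0 : (0 : ℝ) < 1 + v ^ 2 := by positivity
  refine (((hasDerivAt_pow 2 v).const_add 1).rpow_const (p := -γ / 2)
    (Or.inl h0.ne')).congr_deriv ?_
  rw [Real.rpow_sub_one h0.ne', groundState, drift]
  field_simp
  ring

namespace IsSolutionPair

variable {γ η : ℝ} {lam : ℂ} {y z : ℝ → ℂ}

theorem hasDerivAt_energy (h : IsSolutionPair γ lam η y z) (hγ : 0 ≤ γ) (hlam : ‖lam‖ ≤ 1 / 16)
    (hη : 0 ≤ η) {v : ℝ} (hv : 0 ≤ v) :
    HasDerivAt (fun v => energy γ η v (y v) (z v))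
      (deriv (fun v => energy γ η v (y v) (z v)) v) v := by
  obtain ⟨e, he, -⟩ := h.exists_hasDerivAt_energy hγ hlam hη hv
  exact he.differentiableAt.hasDerivAt

theorem le_deriv_energy (h : IsSolutionPair γ lam η y z) (hγ : 0 ≤ γ) (hlam : ‖lam‖ ≤ 1 / 16)
    (hη : 0 ≤ η) {v : ℝ} (hv : 0 ≤ v) :
    (‖twistedDeriv γ v (y v) (z v)‖ ^ 2 + η * v * ‖y v‖ ^ 2) / 2 ≤
      deriv (fun v => energy γ η v (y v) (z v)) v := by
  obtain ⟨e, he, hle⟩ := h.exists_hasDerivAt_energy hγ hlam hη hv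
  rwa [he.deriv]

theorem deriv_energy_nonneg (h : IsSolutionPair γ lam η y z) (hγ : 0 ≤ γ) (hlam : ‖lam‖ ≤ 1 / 16)
    (hη : 0 ≤ η) {v : ℝ} (hv : 0 ≤ v) : 0 ≤ deriv (fun v => energy γ η v (y v) (z v)) v :=
  le_trans (by positivity) (h.le_deriv_energy hγ hlam hη hv)

theorem energy_mono (h : IsSolutionPair γ lam η y z) (hγ : 0 ≤ γ) (hlam : ‖lam‖ ≤ 1 / 16)
    (hη : 0 ≤ η) {r v : ℝ} (hr : 0 ≤ r) (hv : r ≤ v) :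
    energy γ η r (y r) (z r) ≤ energy γ η v (y v) (z v) := by
  have := add_mul_le_of_le_deriv (c := 0)
    (fun s hs => h.hasDerivAt_energy hγ hlam hη (hr.trans hs))
    (fun s hs => h.deriv_energy_nonneg hγ hlam hη (hr.trans hs)) hv
  simpa using this

/-- At `η = 0` the spectral term disappears as well, since `0^{2/3} = 0`. So `D' = -b D` while the
ground state `g` satisfies `g' = b g`. -/
theorem twistedDeriv_mul_groundState (h : IsSolutionPair γ lam 0 y z) (v : ℝ) :
    twistedDeriv γ v (y v) (z v) * (groundState γ v : ℂ) = z 0 := by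
  have hd : ∀ v, HasDerivAt (fun v => twistedDeriv γ v (y v) (z v) * (groundState γ v : ℂ)) 0 v := by
    intro v
    have hD := (h v).2.sub ((hasDerivAt_drift γ v).ofReal_comp.mul (h v).1)
    refine (HasDerivAt.mul (c := fun v => twistedDeriv γ v (y v) (z v)) hD
      (hasDerivAt_groundState γ v).ofReal_comp).congr_deriv ?_
    simp only [schrodingerCoeff, twistedDeriv]
    rw [Real.zero_rpow (by norm_num)]
    push_cast
    ring
  have := is_const_of_deriv_eq_zero (fun v => (hd v).differentiableAt) (fun v => (hd v).deriv) v 0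
  rw [this, twistedDeriv_zero_left, groundState_zero]
  simp

theorem norm_le_norm_twistedDeriv (h : IsSolutionPair γ lam 0 y z) (hγ : 0 ≤ γ) (v : ℝ) :
    ‖z 0‖ ≤ ‖twistedDeriv γ v (y v) (z v)‖ := by
  rw [← h.twistedDeriv_mul_groundState v, norm_mul, Complex.norm_of_nonneg (groundState_pos γ v).le]
  exact mul_le_of_le_one_right (norm_nonneg _) (groundState_le_one hγ v)

theorem energy_linear_growth (h : IsSolutionPair γ lam 0 y z) (hγ : 0 ≤ γ) (hlam : ‖lam‖ ≤ 1 / 16)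
    {v : ℝ} (hv : 0 ≤ v) :
    energy γ 0 0 (y 0) (z 0) + ‖z 0‖ ^ 2 / 2 * v ≤ energy γ 0 v (y v) (z v) := by
  have := add_mul_le_of_le_deriv (c := ‖z 0‖ ^ 2 / 2)
    (fun s hs => h.hasDerivAt_energy hγ hlam le_rfl hs)
    (fun s hs => le_trans (by
      have := pow_le_pow_left₀ (norm_nonneg _) (h.norm_le_norm_twistedDeriv hγ s) 2
      linarith) (h.le_deriv_energy hγ hlam le_rfl hs)) hv
  simpa using this

theorem eq_groundState (h : IsSolutionPair γ lam 0 y z) (hy : y 0 = 1) (hz : z 0 = 0) (v : ℝ) :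
    y v = groundState γ v := by
  have hg : ∀ v, (groundState γ v : ℂ) ≠ 0 := fun v =>
    Complex.ofReal_ne_zero.2 (groundState_pos γ v).ne'
  have hz' : ∀ v, z v = (drift γ v : ℂ) * y v := fun v => by
    have := h.twistedDeriv_mul_groundState v
    rw [hz] at this
    exact sub_eq_zero.1 ((mul_eq_zero.1 this).resolve_right (hg v))
  have hd : ∀ v, HasDerivAt (fun v => y v / (groundState γ v : ℂ)) 0 v := fun v => by
    refine ((h v).1.div (hasDerivAt_groundState γ v).ofReal_comp (hg v)).congr_deriv ?_
    rw [hz']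
    push_cast
    ring
  have := is_const_of_deriv_eq_zero (fun v => (hd v).differentiableAt) (fun v => (hd v).deriv) v 0
  rw [groundState_zero, hy, div_eq_iff (hg v)] at this
  simpa using this

/-! ### The solution vanishing at the origin -/

theorem energy_pos (h : IsSolutionPair γ lam η y z) (hγ : 0 ≤ γ) (hlam : ‖lam‖ ≤ 1 / 16)
    (hη : 0 ≤ η) (hy : y 0 = 0) (hz : z 0 = 1) {v : ℝ} (hv : 0 < v) :
    0 < energy γ η v (y v) (z v) := by
  have h0 : energy γ η 0 (y 0) (z 0) = 0 := by rw [hy, energy_zero]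
  by_contra! hneg
  -- By monotonicity a nonpositive value at `v` would make the energy vanish on `[0, v]`,
  -- contradicting that its derivative at `0` is at least `1/2`.
  have hzero : ∀ s ∈ Icc 0 v, energy γ η s (y s) (z s) = 0 := fun s hs =>
    le_antisymm ((h.energy_mono hγ hlam hη hs.1 hs.2).trans hneg)
      (h0 ▸ h.energy_mono hγ hlam hη le_rfl hs.1)
  have h1 := (h.hasDerivAt_energy hγ hlam hη le_rfl).hasDerivWithinAt (s := Icc 0 v)
  have h2 : HasDerivWithinAt (fun v => energy γ η v (y v) (z v)) 0 (Icc 0 v) 0 :=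
    (hasDerivWithinAt_const 0 (Icc 0 v) (0 : ℝ)).congr hzero (hzero 0 (left_mem_Icc.2 hv.le))
  have h3 := (uniqueDiffOn_Icc hv 0 (left_mem_Icc.2 hv.le)).eq_deriv _ h1 h2
  have h4 := h.le_deriv_energy hγ hlam hη le_rfl
  rw [h3, twistedDeriv_zero_left, hz] at h4
  norm_num at h4

theorem ne_zero (h : IsSolutionPair γ lam η y z) (hγ : 0 ≤ γ) (hlam : ‖lam‖ ≤ 1 / 16)
    (hη : 0 ≤ η) (hy : y 0 = 0) (hz : z 0 = 1) {v : ℝ} (hv : 0 < v) : y v ≠ 0 := by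
  intro h0
  have := h.energy_pos hγ hlam hη hy hz hv
  rw [h0, energy_zero] at this
  exact this.false

/-- Combine `E² ≤ 2 ‖D‖² ‖y‖²` with `‖D‖² ≤ 2 E'`. The right side is the derivative of `-4 / E`, so
the bound integrates explicitly. -/
theorem inv_sq_norm_le (h : IsSolutionPair γ lam η y z) (hγ : 0 ≤ γ) (hlam : ‖lam‖ ≤ 1 / 16)
    (hη : 0 ≤ η) (hy : y 0 = 0) (hz : z 0 = 1) {v : ℝ} (hv : 0 < v) :
    1 / ‖y v‖ ^ 2 ≤ 4 * (deriv (fun v => energy γ η v (y v) (z v)) v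
      / energy γ η v (y v) (z v) ^ 2) := by
  have hE := h.energy_pos hγ hlam hη hy hz hv
  have h1 := sq_energy_le hη hv.le (y v) (z v) hE.le
  have h2 := h.le_deriv_energy hγ hlam hη hv.le
  have hn : 0 < ‖y v‖ := norm_pos_iff.2 (h.ne_zero hγ hlam hη hy hz hv)
  have h3 : 0 ≤ η * v * ‖y v‖ ^ 2 := by positivity
  rw [← mul_div_assoc, div_le_div_iff₀ (by positivity) (by positivity)]
  have h4 : ‖twistedDeriv γ v (y v) (z v)‖ ^ 2 * ‖y v‖ ^ 2
      ≤ 2 * deriv (fun v => energy γ η v (y v) (z v)) v * ‖y v‖ ^ 2 := by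
    gcongr
    linarith
  linarith

theorem hasDerivAt_neg_inv_energy (h : IsSolutionPair γ lam η y z) (hγ : 0 ≤ γ)
    (hlam : ‖lam‖ ≤ 1 / 16) (hη : 0 ≤ η) (hy : y 0 = 0) (hz : z 0 = 1) {v : ℝ} (hv : 0 < v) :
    HasDerivAt (fun v => -4 * (energy γ η v (y v) (z v))⁻¹)
      (4 * (deriv (fun v => energy γ η v (y v) (z v)) v / energy γ η v (y v) (z v) ^ 2)) v := by
  refine (((h.hasDerivAt_energy hγ hlam hη hv.le).inv
    (h.energy_pos hγ hlam hη hy hz hv).ne').const_mul (-4)).congr_deriv ?_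
  ring

theorem tendsto_energy (h : IsSolutionPair γ lam η y z) (hγ : 0 ≤ γ) (hlam : ‖lam‖ ≤ 1 / 16)
    (hη : 0 ≤ η) (hy : y 0 = 0) (hz : z 0 = 1) :
    Filter.Tendsto (fun v => energy γ η v (y v) (z v)) Filter.atTop Filter.atTop := by
  suffices ∃ c k : ℝ, 0 < c ∧ ∀ v, 1 ≤ v → k + c * v ≤ energy γ η v (y v) (z v) by
    obtain ⟨c, k, hc, hle⟩ := this
    refine Filter.tendsto_atTop_mono' _ ((Filter.eventually_ge_atTop 1).mono hle) ?_
    exact Filter.tendsto_atTop_add_const_left _ _ (Filter.tendsto_id.const_mul_atTop hc)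
  rcases hη.eq_or_lt with rfl | hη'
  · refine ⟨1 / 2, 0, by norm_num, fun v hv => ?_⟩
    have := h.energy_linear_growth hγ hlam (zero_le_one.trans hv)
    rw [hy, hz, energy_zero, norm_one] at this
    linarith
  · have h1 := h.energy_pos hγ hlam hη hy hz one_pos
    set E₁ := energy γ η 1 (y 1) (z 1)
    -- For `s ≥ 1`, the arithmetic-geometric mean inequality gives `E' ≥ (‖D‖² + η ‖y‖²) / 2 ≥ √η
    -- ‖D‖ ‖y‖ ≥ √(η / 2) E ≥ √(η / 2) E₁`.
    refine ⟨√(η / 2) * E₁, E₁ - √(η / 2) * E₁, by positivity, fun v hv => ?_⟩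
    have := add_mul_le_of_le_deriv (c := √(η / 2) * E₁)
      (fun s (hs : 1 ≤ s) => h.hasDerivAt_energy hγ hlam hη (zero_le_one.trans hs))
      (fun s (hs : 1 ≤ s) => ?_) hv
    · linarith
    · have hs0 : 0 < s := zero_lt_one.trans_le hs
      refine le_trans ?_ (h.le_deriv_energy hγ hlam hη hs0.le)
      have h2 := sq_energy_le hη hs0.le (y s) (z s) (h.energy_pos hγ hlam hη hy hz hs0).le
      have h3 := pow_le_pow_left₀ h1.le (h.energy_mono hγ hlam hη zero_le_one hs) 2
      set D := ‖twistedDeriv γ s (y s) (z s)‖ ^ 2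
      have hD : 0 ≤ D := by positivity
      set N := ‖y s‖ ^ 2
      have hN : 0 ≤ N := by positivity
      have h4 : η * N ≤ η * s * N := by
        have : η * 1 * N ≤ η * s * N := by gcongr
        simpa using this
      refine le_trans ?_ (show (D + η * N) / 2 ≤ _ by linarith)
      refine le_of_sq_le_sq ?_ (by positivity)
      rw [mul_pow, Real.sq_sqrt (by positivity)]
      have h5 : η * E₁ ^ 2 ≤ η * (2 * (D * N)) := by
        gcongr
        exact h3.trans h2
      nlinarith [sq_nonneg (D - η * N)]

end IsSolutionPair

/-! ### The square integrable solution -/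

/-- The slope at `0` of the solution with boundary values `1` at `0` and `0` at `k + 1`. -/
noncomputable def dirichletSlope (φ ψ : ℂ → ℝ → ℝ → ℂ) (k : ℕ) (p : ℂ × ℝ) : ℂ :=
  -φ p.1 p.2 (k + 1) / ψ p.1 p.2 (k + 1)

/-- The limit of the Dirichlet slopes. -/
noncomputable def limitSlope (φ ψ : ℂ → ℝ → ℝ → ℂ) (p : ℂ × ℝ) : ℂ :=
  Filter.atTop.limUnder fun k => dirichletSlope φ ψ k p

/-- The parameters with `‖lam‖ ≤ 1 / 16` and `0 ≤ η`. -/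
def parameterRegion : Set (ℂ × ℝ) := {p | ‖p.1‖ ≤ 1 / 16 ∧ 0 ≤ p.2}

/-! ### Convergence and regularity of the Dirichlet slopes. -/

namespace IsFundamentalSystem

variable {γ : ℝ} {φ φ' ψ ψ' : ℂ → ℝ → ℝ → ℂ} {p : ℂ × ℝ}

theorem snd_ne_zero (h : IsFundamentalSystem γ φ φ' ψ ψ') (hγ : 0 ≤ γ) (hp : p ∈ parameterRegion)
    {v : ℝ} (hv : 0 < v) : ψ p.1 p.2 v ≠ 0 :=
  (h.pair_snd p.1 p.2).ne_zero hγ hp.1 hp.2 (h.snd_zero _ _) (h.snd_deriv_zero _ _) hv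

theorem norm_dirichletSlope_sub_le (h : IsFundamentalSystem γ φ φ' ψ ψ') (hγ : 0 ≤ γ)
    (hp : p ∈ parameterRegion) {k n : ℕ} (hkn : k ≤ n) :
    ‖dirichletSlope φ ψ n p - dirichletSlope φ ψ k p‖ ≤
      4 * (energy γ p.2 (k + 1) (ψ p.1 p.2 (k + 1)) (ψ' p.1 p.2 (k + 1)))⁻¹ := by
  have hψ := h.pair_snd p.1 p.2
  have hφ := h.pair_fst p.1 p.2
  have h0 := h.snd_zero p.1 p.2
  have h1 := h.snd_deriv_zero p.1 p.2
  set E : ℝ → ℝ := fun v => energy γ p.2 v (ψ p.1 p.2 v) (ψ' p.1 p.2 v) with hEdef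
  have hpos : ∀ v : ℝ, (k + 1 : ℝ) ≤ v → 0 < v := fun v hv => lt_of_lt_of_le (by positivity) hv
  have hd : ∀ v : ℝ, (k + 1 : ℝ) ≤ v →
      HasDerivAt (fun v => -φ p.1 p.2 v / ψ p.1 p.2 v - dirichletSlope φ ψ k p)
        (1 / ψ p.1 p.2 v ^ 2) v := fun v hv => by
    -- The numerator of `(-φ / ψ)'` is the Wronskian of `φ` and `ψ`, which equals `1`.
    refine (((hφ v).1.neg.div (hψ v).1 (h.snd_ne_zero hγ hp (hpos v hv))).sub_const _).congr_deriv ?_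
    have := h.wronskian p.1 p.2 v
    congr 1
    simp only [Pi.neg_apply]
    linear_combination this
  have hB : ∀ v : ℝ, (k + 1 : ℝ) ≤ v →
      HasDerivAt (fun v => -4 * (E v)⁻¹ - (-4) * (E (k + 1))⁻¹) (4 * (deriv E v / E v ^ 2)) v :=
    fun v hv => (hψ.hasDerivAt_neg_inv_energy hγ hp.1 hp.2 h0 h1 (hpos v hv)).sub_const _
  have hkn' : (k + 1 : ℝ) ≤ n + 1 := by exact_mod_cast Nat.succ_le_succ hkn
  have key := image_norm_le_of_norm_deriv_right_le_deriv_boundary'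
    (a := (k + 1 : ℝ)) (b := n + 1)
    (fun v hv => (hd v hv.1).continuousAt.continuousWithinAt)
    (fun v hv => (hd v hv.1).hasDerivWithinAt)
    (by simp [dirichletSlope])
    (fun v hv => (hB v hv.1).continuousAt.continuousWithinAt)
    (fun v hv => (hB v hv.1).hasDerivWithinAt)
    (fun v hv => by
      rw [norm_div, norm_one, norm_pow]
      exact hψ.inv_sq_norm_le hγ hp.1 hp.2 h0 h1 (hpos v hv.1)) (right_mem_Icc.2 hkn')
  have hEn : 0 < E (n + 1) := hψ.energy_pos hγ hp.1 hp.2 h0 h1 (by positivity)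
  have : 0 < (E (n + 1))⁻¹ := inv_pos.2 hEn
  refine key.trans ?_
  change -4 * (E (n + 1))⁻¹ - (-4) * (E (k + 1))⁻¹ ≤ 4 * (E (k + 1))⁻¹
  linarith

theorem tendsto_energy_nat (h : IsFundamentalSystem γ φ φ' ψ ψ') (hγ : 0 ≤ γ)
    (hp : p ∈ parameterRegion) :
    Filter.Tendsto (fun k : ℕ => energy γ p.2 (k + 1) (ψ p.1 p.2 (k + 1)) (ψ' p.1 p.2 (k + 1)))
      Filter.atTop Filter.atTop :=
  ((h.pair_snd p.1 p.2).tendsto_energy hγ hp.1 hp.2 (h.snd_zero _ _) (h.snd_deriv_zero _ _)).comp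
    (Filter.tendsto_atTop_add_const_right _ 1 tendsto_natCast_atTop_atTop)

theorem tendsto_dirichletSlope (h : IsFundamentalSystem γ φ φ' ψ ψ') (hγ : 0 ≤ γ)
    (hp : p ∈ parameterRegion) :
    Filter.Tendsto (fun k => dirichletSlope φ ψ k p) Filter.atTop (nhds (limitSlope φ ψ p)) := by
  refine CauchySeq.tendsto_limUnder (cauchySeq_of_le_tendsto_0' (fun k : ℕ => 4 *
    (energy γ p.2 (k + 1) (ψ p.1 p.2 (k + 1)) (ψ' p.1 p.2 (k + 1)))⁻¹) (fun k n hkn => ?_) ?_)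
  · rw [dist_comm, dist_eq_norm]
    exact h.norm_dirichletSlope_sub_le hγ hp hkn
  · simpa using (h.tendsto_energy_nat hγ hp).inv_tendsto_atTop.const_mul 4

theorem norm_limitSlope_sub_le (h : IsFundamentalSystem γ φ φ' ψ ψ') (hγ : 0 ≤ γ)
    (hp : p ∈ parameterRegion) {k n : ℕ} (hkn : k ≤ n) :
    ‖limitSlope φ ψ p - dirichletSlope φ ψ n p‖ ≤
      4 * (energy γ p.2 (k + 1) (ψ p.1 p.2 (k + 1)) (ψ' p.1 p.2 (k + 1)))⁻¹ := by
  have hk : 0 < energy γ p.2 (k + 1) (ψ p.1 p.2 (k + 1)) (ψ' p.1 p.2 (k + 1)) :=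
    (h.pair_snd p.1 p.2).energy_pos hγ hp.1 hp.2 (h.snd_zero _ _) (h.snd_deriv_zero _ _)
      (by positivity)
  have hmono := (h.pair_snd p.1 p.2).energy_mono hγ hp.1 hp.2 (r := k + 1) (v := n + 1)
    (by positivity) (by exact_mod_cast Nat.succ_le_succ hkn)
  refine le_trans (le_of_tendsto
    ((h.tendsto_dirichletSlope hγ hp).sub_const (dirichletSlope φ ψ n p)).norm
    ((Filter.eventually_ge_atTop n).mono fun m hm => h.norm_dirichletSlope_sub_le hγ hp hm)) ?_
  gcongr

theorem continuousOn_energy (h : IsFundamentalSystem γ φ φ' ψ ψ') {v : ℝ} (hv : 0 ≤ v) :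
    ContinuousOn (fun p : ℂ × ℝ => energy γ p.2 v (ψ p.1 p.2 v) (ψ' p.1 p.2 v))
      parameterRegion := by
  have h1 : Continuous fun p : ℂ × ℝ => ψ p.1 p.2 v :=
    h.continuous_snd.comp (Continuous.prodMk_left v)
  have h2 : Continuous fun p : ℂ × ℝ => ψ' p.1 p.2 v :=
    h.continuous_snd_deriv.comp (Continuous.prodMk_left v)
  have h3 : Continuous fun p : ℂ × ℝ => p.2 ^ (1 / 3 : ℝ) :=
    (Real.continuous_rpow_const (by norm_num)).comp _root_.continuous_snd
  have h4 : ContinuousOn (fun p : ℂ × ℝ => p.2 ^ (1 / 3 : ℝ) / (4 * (1 + p.2 ^ (1 / 3 : ℝ) * v)))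
      parameterRegion := by
    refine h3.continuousOn.div
      (continuous_const.mul (continuous_const.add (h3.mul continuous_const))).continuousOn fun p hp => ?_
    have := Real.rpow_nonneg hp.2 (1 / 3)
    positivity
  have h5 : Continuous fun p : ℂ × ℝ => twistedDeriv γ v (ψ p.1 p.2 v) (ψ' p.1 p.2 v) := by
    unfold twistedDeriv
    fun_prop
  have h6 := Complex.continuous_re.comp h5
  have h7 := Complex.continuous_im.comp h5
  have h8 := Complex.continuous_re.comp h1
  have h9 := Complex.continuous_im.comp h1
  exact (((h6.mul h8).add (h7.mul h9)).add ((h7.mul h8).sub (h6.mul h9))).continuousOn.sub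
    (h4.mul ((h8.pow 2).add (h9.pow 2)).continuousOn)

/-- A Dini-type argument: the error bound `4 / E` at one large point `N + 1` is continuous in the
parameters and controls all `n ≥ N`. -/
theorem tendstoLocallyUniformlyOn_dirichletSlope (h : IsFundamentalSystem γ φ φ' ψ ψ')
    (hγ : 0 ≤ γ) :
    TendstoLocallyUniformlyOn (dirichletSlope φ ψ) (limitSlope φ ψ) Filter.atTop
      parameterRegion := by
  rw [Metric.tendstoLocallyUniformlyOn_iff]
  intro ε hε p hp
  obtain ⟨N, hN⟩ := ((h.tendsto_energy_nat hγ hp).eventually_gt_atTop (4 / ε)).exists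
  have hc := (h.continuousOn_energy (v := N + 1) (by positivity)) p hp
  refine ⟨{p' | 4 / ε < energy γ p'.2 (N + 1) (ψ p'.1 p'.2 (N + 1)) (ψ' p'.1 p'.2 (N + 1))}
      ∩ parameterRegion,
    Filter.inter_mem (hc.eventually_const_lt hN) self_mem_nhdsWithin, ?_⟩
  filter_upwards [Filter.eventually_ge_atTop N] with n hn p' hp'
  rw [dist_eq_norm]
  refine (h.norm_limitSlope_sub_le hγ hp'.2 hn).trans_lt ?_
  have h1 : 4 / ε < _ := hp'.1
  have h2 : 0 < 4 / ε := by positivity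
  rw [← div_eq_mul_inv, div_lt_iff₀ (h2.trans h1), mul_comm, ← div_lt_iff₀ hε]
  exact h1

theorem continuousOn_limitSlope (h : IsFundamentalSystem γ φ φ' ψ ψ') (hγ : 0 ≤ γ) :
    ContinuousOn (limitSlope φ ψ) parameterRegion := by
  refine (h.tendstoLocallyUniformlyOn_dirichletSlope hγ).continuousOn
    (Filter.Frequently.of_forall fun k => ?_)
  exact (h.continuous_fst.comp (Continuous.prodMk_left _)).neg.continuousOn.div
    (h.continuous_snd.comp (Continuous.prodMk_left _)).continuousOn
    fun p hp => h.snd_ne_zero hγ hp (by positivity)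

theorem differentiableOn_limitSlope (h : IsFundamentalSystem γ φ φ' ψ ψ') (hγ : 0 ≤ γ) {η : ℝ}
    (hη : 0 ≤ η) :
    DifferentiableOn ℂ (fun lam => limitSlope φ ψ (lam, η)) (Metric.ball 0 (1 / 16)) := by
  have hmaps : MapsTo (fun lam : ℂ => (lam, η)) (Metric.ball 0 (1 / 16)) parameterRegion :=
    fun lam hlam => ⟨by simpa using (mem_ball_zero_iff.1 hlam).le, hη⟩
  refine ((h.tendstoLocallyUniformlyOn_dirichletSlope hγ).comp (fun lam : ℂ => (lam, η)) hmaps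
    (by fun_prop)).differentiableOn (Filter.Eventually.of_forall fun k => ?_) Metric.isOpen_ball
  exact (h.differentiable_fst η _).neg.differentiableOn.div
    (h.differentiable_snd η _).differentiableOn
    fun lam hlam => h.snd_ne_zero hγ (hmaps hlam) (by positivity)

/-- The square integrable solution. -/
noncomputable def decaying (φ ψ : ℂ → ℝ → ℝ → ℂ) (p : ℂ × ℝ) (v : ℝ) : ℂ :=
  φ p.1 p.2 v + limitSlope φ ψ p * ψ p.1 p.2 v

theorem pair_decaying (h : IsFundamentalSystem γ φ φ' ψ ψ') (p : ℂ × ℝ) :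
    IsSolutionPair γ p.1 p.2 (decaying φ ψ p)
      (fun v => φ' p.1 p.2 v + limitSlope φ ψ p * ψ' p.1 p.2 v) :=
  (h.pair_fst p.1 p.2).add_mul (h.pair_snd p.1 p.2) _

theorem decaying_zero (h : IsFundamentalSystem γ φ φ' ψ ψ') (p : ℂ × ℝ) :
    decaying φ ψ p 0 = 1 := by
  simp [decaying, h.fst_zero, h.snd_zero]

/-- The approximating solution vanishes at `k + 1`, so its energy is `0` there and at most `0`
before; the sign survives the limit in `k`. -/
theorem energy_decaying_nonpos (h : IsFundamentalSystem γ φ φ' ψ ψ') (hγ : 0 ≤ γ)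
    (hp : p ∈ parameterRegion) {v : ℝ} (hv : 0 ≤ v) :
    energy γ p.2 v (decaying φ ψ p v) (φ' p.1 p.2 v + limitSlope φ ψ p * ψ' p.1 p.2 v) ≤ 0 := by
  have hc : Continuous fun m : ℂ => energy γ p.2 v (φ p.1 p.2 v + m * ψ p.1 p.2 v)
      (φ' p.1 p.2 v + m * ψ' p.1 p.2 v) := by
    unfold energy twistedDeriv
    fun_prop
  refine le_of_tendsto ((hc.tendsto _).comp (h.tendsto_dirichletSlope hγ hp)) ?_
  obtain ⟨N, hN⟩ := exists_nat_ge v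
  filter_upwards [Filter.eventually_ge_atTop N] with k hk
  have hvk : v ≤ k + 1 := by
    have : (N : ℝ) ≤ k := by exact_mod_cast hk
    linarith
  have := ((h.pair_fst p.1 p.2).add_mul (h.pair_snd p.1 p.2)
    (dirichletSlope φ ψ k p)).energy_mono hγ hp.1 hp.2 hv hvk
  refine this.trans (le_of_eq ?_)
  have hne := h.snd_ne_zero hγ hp (v := (k + 1 : ℝ)) (by positivity)
  have h0 : φ p.1 p.2 (k + 1) + dirichletSlope φ ψ k p * ψ p.1 p.2 (k + 1) = 0 := by
    rw [dirichletSlope]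
    field_simp
    ring
  simp only [h0, energy_zero]

/-! ### Square integrability of the limit solution, and uniqueness. -/

theorem integrableOn_of_pos (h : IsFundamentalSystem γ φ φ' ψ ψ') (hγ : 0 ≤ γ)
    (hp : p ∈ parameterRegion) (hη : 0 < p.2) :
    IntegrableOn (fun v => ‖decaying φ ψ p v‖ ^ 2) (Ioi 1) := by
  have hJ := h.pair_decaying p
  set E : ℝ → ℝ := fun v => energy γ p.2 v (decaying φ ψ p v)
    (φ' p.1 p.2 v + limitSlope φ ψ p * ψ' p.1 p.2 v) with hE
  -- Freezing `E` to the left of `0` makes it monotone on the whole line, so that it converges to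
  -- its supremum.
  have hmono : Monotone fun v => E (max v 0) := fun r v hrv =>
    hJ.energy_mono hγ hp.1 hp.2 (le_max_right r 0) (max_le_max_right 0 hrv)
  have hbdd : BddAbove (range fun v => E (max v 0)) :=
    ⟨0, by rintro _ ⟨v, rfl⟩; exact h.energy_decaying_nonpos hγ hp (le_max_right v 0)⟩
  have hlim : Filter.Tendsto E Filter.atTop (nhds (⨆ v, E (max v 0))) :=
    (tendsto_atTop_ciSup hmono hbdd).congr' ((Filter.eventually_ge_atTop 0).mono fun v hv => by
      simp [max_eq_left hv])
  have hint : IntegrableOn (deriv E) (Ioi 1) := integrableOn_Ioi_deriv_of_nonneg'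
    (fun v hv => hJ.hasDerivAt_energy hγ hp.1 hp.2 (zero_le_one.trans hv))
    (fun v hv => hJ.deriv_energy_nonneg hγ hp.1 hp.2 (zero_le_one.trans (le_of_lt hv))) hlim
  refine (hint.const_mul (2 / p.2)).mono' (hJ.continuous.norm.pow 2).aestronglyMeasurable ?_
  filter_upwards [ae_restrict_mem measurableSet_Ioi] with v hv
  have hv1 : 1 < v := hv
  have hle := hJ.le_deriv_energy hγ hp.1 hp.2 (zero_le_one.trans hv1.le)
  have h1 : p.2 * 1 * ‖decaying φ ψ p v‖ ^ 2 ≤ p.2 * v * ‖decaying φ ψ p v‖ ^ 2 := by gcongr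
  have h2 : p.2 * ‖decaying φ ψ p v‖ ^ 2 ≤ 2 * deriv E v := by
    have := sq_nonneg ‖twistedDeriv γ v (decaying φ ψ p v)
      (φ' p.1 p.2 v + limitSlope φ ψ p * ψ' p.1 p.2 v)‖
    linarith
  rw [Real.norm_of_nonneg (by positivity), div_mul_eq_mul_div, le_div_iff₀ hη]
  linarith

theorem integrable_of_eq_zero (h : IsFundamentalSystem γ φ φ' ψ ψ') (hγ : 1 / 2 < γ) {lam : ℂ}
    (hp : (lam, (0 : ℝ)) ∈ parameterRegion) :
    Integrable fun v => ‖decaying φ ψ (lam, 0) v‖ ^ 2 := by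
  have hγ0 : 0 ≤ γ := by linarith
  have hJ := h.pair_decaying (lam, 0)
  -- A nonzero slope would make the energy grow linearly, against its nonpositivity.
  have hslope : limitSlope φ ψ (lam, 0) = 0 := by
    by_contra hne
    set m := limitSlope φ ψ (lam, 0)
    have hm : 0 < ‖m‖ ^ 2 / 2 := by have := norm_pos_iff.2 hne; positivity
    set E₀ := energy γ 0 0 1 m with hE₀
    have hgrow : ∀ v : ℝ, 0 ≤ v → E₀ + ‖m‖ ^ 2 / 2 * v ≤ 0 := fun v hv => by
      have h1 := hJ.energy_linear_growth hγ0 hp.1 hv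
      simp only [h.decaying_zero, h.fst_deriv_zero, h.snd_deriv_zero, zero_add, mul_one] at h1
      exact h1.trans (h.energy_decaying_nonpos hγ0 hp hv)
    have h2 := hgrow ((|E₀| + 1) / (‖m‖ ^ 2 / 2)) (by positivity)
    rw [mul_div_cancel₀ _ hm.ne'] at h2
    linarith [neg_abs_le E₀]
  have heq : ∀ v, decaying φ ψ (lam, 0) v = groundState γ v := hJ.eq_groundState
    (h.decaying_zero _) (by simp [h.fst_deriv_zero, hslope])
  -- The square of the ground state is `(1 + v²)^(-γ)`, integrable on the line because `2γ > 1`;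
  -- this is where the threshold `1/2` enters.
  have := integrable_rpow_neg_one_add_norm_sq (E := ℝ) (μ := volume) (r := 2 * γ)
    (by simp; linarith)
  refine this.congr (Filter.Eventually.of_forall fun v => ?_)
  have h0 : (0 : ℝ) ≤ 1 + v ^ 2 := by positivity
  simp only [heq, Complex.norm_of_nonneg (groundState_pos γ v).le, Real.norm_eq_abs, sq_abs]
  rw [groundState, ← Real.rpow_mul_natCast h0]
  congr 1
  push_cast
  ring

theorem memLp_decaying (h : IsFundamentalSystem γ φ φ' ψ ψ') (hγ : 1 / 2 < γ)
    (hp : p ∈ parameterRegion) :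
    MemLp (decaying φ ψ p) 2 (volume.restrict (Ici (0 : ℝ))) := by
  have hc := (h.pair_decaying p).continuous
  rw [memLp_two_iff_integrable_sq_norm hc.aestronglyMeasurable]
  obtain ⟨lam, η⟩ := p
  rcases hp.2.eq_or_lt with h0 | h0
  · obtain rfl : (0 : ℝ) = η := h0
    exact (h.integrable_of_eq_zero hγ hp).integrableOn
  · have h1 := h.integrableOn_of_pos (by linarith) hp h0
    have h2 : IntegrableOn (fun v => ‖decaying φ ψ (lam, η) v‖ ^ 2) (Icc 0 1) :=
      (hc.norm.pow 2).integrableOn_Icc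
    exact (h2.union h1).mono_set fun v (hv : 0 ≤ v) =>
      (le_or_gt v 1).imp (fun h => ⟨hv, h⟩) id

theorem isL2Solution_decaying (h : IsFundamentalSystem γ φ φ' ψ ψ') (hγ : 1 / 2 < γ)
    (hp : p ∈ parameterRegion) : IsL2Solution γ p.1 p.2 (decaying φ ψ p) where
  ode := by
    refine ⟨_, _, fun v _ => ⟨((h.pair_decaying p) v).1.hasDerivWithinAt,
      ((h.pair_decaying p) v).2.hasDerivWithinAt, ?_⟩⟩
    simp only [schrodingerCoeff]
    ring
  value_zero := h.decaying_zero p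
  memLp := h.memLp_decaying hγ hp

theorem not_memLp_snd (h : IsFundamentalSystem γ φ φ' ψ ψ') (hγ : 0 ≤ γ)
    (hp : p ∈ parameterRegion) :
    ¬ MemLp (ψ p.1 p.2) 2 (volume.restrict (Ici (0 : ℝ))) := by
  intro hL
  have hψ := h.pair_snd p.1 p.2
  have h0 := h.snd_zero p.1 p.2
  have h1 := h.snd_deriv_zero p.1 p.2
  have hpos : ∀ v : ℝ, 1 ≤ v → 0 < v := fun v hv => zero_lt_one.trans_le hv
  rw [memLp_two_iff_integrable_sq_norm hψ.continuous.aestronglyMeasurable] at hL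
  have hL' : IntegrableOn (fun v => ‖ψ p.1 p.2 v‖ ^ 2) (Ioi 1) :=
    IntegrableOn.mono_set hL fun v (hv : 1 < v) => zero_le_one.trans hv.le
  have hlim : Filter.Tendsto (fun v => -4 * (energy γ p.2 v (ψ p.1 p.2 v) (ψ' p.1 p.2 v))⁻¹)
      Filter.atTop (nhds (-4 * 0)) :=
    (hψ.tendsto_energy hγ hp.1 hp.2 h0 h1).inv_tendsto_atTop.const_mul (-4)
  have hI := integrableOn_Ioi_deriv_of_nonneg' (a := 1)
    (fun v hv => hψ.hasDerivAt_neg_inv_energy hγ hp.1 hp.2 h0 h1 (hpos v hv))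
    (fun v hv => le_trans (by positivity)
      (hψ.inv_sq_norm_le hγ hp.1 hp.2 h0 h1 (hpos v (le_of_lt hv)))) hlim
  have hconst : IntegrableOn (fun _ : ℝ => (1 : ℝ)) (Ioi 1) := by
    refine (hL'.add hI).mono' aestronglyMeasurable_const ?_
    filter_upwards [ae_restrict_mem measurableSet_Ioi] with v hv
    have hv0 := hpos v (le_of_lt hv)
    have hle := hψ.inv_sq_norm_le hγ hp.1 hp.2 h0 h1 hv0
    have hn : 0 < ‖ψ p.1 p.2 v‖ ^ 2 := by
      have := norm_pos_iff.2 (h.snd_ne_zero hγ hp hv0)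
      positivity
    rw [norm_one, Pi.add_apply]
    refine le_trans ?_ (add_le_add_right hle _)
    rcases le_total 1 (‖ψ p.1 p.2 v‖ ^ 2) with h2 | h2
    · have : 0 ≤ 1 / ‖ψ p.1 p.2 v‖ ^ 2 := by positivity
      linarith
    · have : 1 ≤ 1 / ‖ψ p.1 p.2 v‖ ^ 2 := (one_le_div hn).2 h2
      linarith
  simp [integrableOn_const_iff] at hconst

/-- The Wronskians of `f` with `φ` and `ψ` are constant on the half-line, where only one-sided
derivatives exist at `0`; solving for `f` gives `c = f₁ 0`. -/
theorem eq_add_mul_of_solvesODE (h : IsFundamentalSystem γ φ φ' ψ ψ') {lam : ℂ} {η : ℝ}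
    {f : ℝ → ℂ} (hf : SolvesODE γ lam η f) (h0 : f 0 = 1) :
    ∃ c : ℂ, ∀ v, 0 ≤ v → f v = φ lam η v + c * ψ lam η v := by
  obtain ⟨f₁, f₂, hf⟩ := hf
  have hconst : ∀ y z : ℝ → ℂ, IsSolutionPair γ lam η y z → ∀ v, 0 ≤ v →
      f v * z v - f₁ v * y v = f 0 * z 0 - f₁ 0 * y 0 := by
    intro y z hy v hv
    have hd : ∀ s, 0 ≤ s → HasDerivWithinAt (fun s => f s * z s - f₁ s * y s) 0 (Ici 0) s := by
      intro s hs
      obtain ⟨g1, g2, g3⟩ := hf s hs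
      refine ((g1.mul (hy s).2.hasDerivWithinAt).sub
        (g2.mul (hy s).1.hasDerivWithinAt)).congr_deriv ?_
      simp only [schrodingerCoeff]
      linear_combination y s * g3
    exact constant_of_has_deriv_right_zero
      (fun s hs => (hd s hs.1).continuousWithinAt.mono Icc_subset_Ici_self)
      (fun s hs => (hd s hs.1).mono (Ici_subset_Ici.2 hs.1)) v (right_mem_Icc.2 hv)
  refine ⟨f₁ 0, fun v hv => ?_⟩
  have h1 := hconst _ _ (h.pair_fst lam η) v hv
  have h2 := hconst _ _ (h.pair_snd lam η) v hv
  rw [h0, h.fst_zero, h.fst_deriv_zero] at h1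
  rw [h0, h.snd_zero, h.snd_deriv_zero] at h2
  linear_combination φ lam η v * h2 - ψ lam η v * h1 - f v * h.wronskian lam η v

theorem eqOn_decaying (h : IsFundamentalSystem γ φ φ' ψ ψ') (hγ : 1 / 2 < γ)
    (hp : p ∈ parameterRegion) {f : ℝ → ℂ} (hf : IsL2Solution γ p.1 p.2 f) :
    EqOn f (decaying φ ψ p) (Ici 0) := by
  obtain ⟨c, hc⟩ := h.eq_add_mul_of_solvesODE hf.ode hf.value_zero
  have hdiff : ∀ v, 0 ≤ v →
      f v - decaying φ ψ p v = (c - limitSlope φ ψ p) * ψ p.1 p.2 v := fun v hv => by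
    rw [hc v hv, decaying]
    ring
  by_cases hne : c - limitSlope φ ψ p = 0
  · intro v hv
    have := hdiff v hv
    rwa [hne, zero_mul, sub_eq_zero] at this
  · refine absurd ?_ (h.not_memLp_snd (by linarith) hp)
    have hm := (hf.memLp.sub (h.memLp_decaying hγ hp)).const_mul (c - limitSlope φ ψ p)⁻¹
    refine hm.ae_eq ?_
    filter_upwards [ae_restrict_mem measurableSet_Ici] with v hv
    rw [Pi.sub_apply, hdiff v hv, inv_mul_cancel_left₀ hne]

end IsFundamentalSystem

theorem mainTheorem7 (γ : ℝ) (hγ : 1 / 2 < γ) :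
    ∃ lam₀ : ℝ, 0 < lam₀ ∧ ∃ η₀ : ℝ, 0 < η₀ ∧ ∃ J : ℂ → ℝ → ℝ → ℂ,
      (∀ lam ∈ Metric.closedBall (0 : ℂ) lam₀, ∀ η ∈ Icc (0 : ℝ) η₀,
        IsL2Solution γ lam η (J lam η) ∧
        ∀ f : ℝ → ℂ, IsL2Solution γ lam η f → EqOn f (J lam η) (Ici 0)) ∧
      ContinuousOn (fun p : ℂ × ℝ × ℝ => J p.1 p.2.1 p.2.2)
        (Metric.closedBall (0 : ℂ) lam₀ ×ˢ Icc (0 : ℝ) η₀ ×ˢ Ici (0 : ℝ)) ∧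
      ∀ η ∈ Icc (0 : ℝ) η₀, ∀ v ∈ Ici (0 : ℝ),
        DifferentiableOn ℂ (fun lam => J lam η v) (Metric.ball (0 : ℂ) lam₀) := by
  obtain ⟨φ, φ', ψ, ψ', h⟩ := exists_isFundamentalSystem γ
  have hγ0 : 0 ≤ γ := by linarith
  -- The radius comes from `energy_inequality`; the bound on `η` is arbitrary, since the estimates
  -- hold for every `η ≥ 0`.
  refine ⟨1 / 16, by norm_num, 1, one_pos,
    fun lam η v => IsFundamentalSystem.decaying φ ψ (lam, η) v, ?_, ?_, ?_⟩
  · intro lam hlam η hη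
    have hp : (lam, η) ∈ parameterRegion := ⟨mem_closedBall_zero_iff.1 hlam, hη.1⟩
    exact ⟨h.isL2Solution_decaying hγ hp, fun f hf => h.eqOn_decaying hγ hp hf⟩
  · have hassoc : Continuous fun x : ℂ × ℝ × ℝ => ((x.1, x.2.1), x.2.2) := by fun_prop
    have hm : ContinuousOn (fun x : ℂ × ℝ × ℝ => limitSlope φ ψ (x.1, x.2.1))
        (Metric.closedBall (0 : ℂ) (1 / 16) ×ˢ Icc (0 : ℝ) 1 ×ˢ Ici (0 : ℝ)) :=
      (h.continuousOn_limitSlope hγ0).comp (by fun_prop)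
        fun x hx => ⟨mem_closedBall_zero_iff.1 hx.1, hx.2.1.1⟩
    exact (h.continuous_fst.comp hassoc).continuousOn.add
      (hm.mul (h.continuous_snd.comp hassoc).continuousOn)
  · intro η hη v _
    exact (h.differentiable_fst η v).differentiableOn.add
      ((h.differentiableOn_limitSlope hγ0 hη.1).mul (h.differentiable_snd η v).differentiableOn)
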